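/- Let $m\ge 1$ and let $\mathbf d=(d_1,\dots,d_m)$ and $\boldsymbol\delta=(\delta_1,\dots,\delta_m)$ be vectors of positive integers such that $\delta_i d_j\neq\delta_j d_i$ for all $i\ne j$. For $1\le i\le m$ let $\mathbf d_i=(d_{i,1},\dots,d_{i,m})$ be the vector of nonzero integers with $d_{i,i}=d_i$ and $d_{i,j}=\delta_i d_j-\delta_j d_i$ for $j\neq i$. Notation. For a vector $\mathbf e=(e_1,\dots,e_m)$ of nonzero integers put $\sigma_1(\mathbf e)=\sum_j e_j$, $\pi(\mathbf e)=\prod_j e_j$, $|\mathbf e|=(|e_1|,\dots,|e_m|)$. If all $e_j>0$, then $W(s,\mathbf e)$ is the number of $\mathbf x\in\mathbb Z_{\ge0}^m$ with $\sum_j e_jx_j=s$; in general $W(s,\mathbf e)=(-1)^K\,W\bigl(s+\sum_{e_j<0}e_j,\,|\mathbf e|\bigr)$, where $K$ is the number of negative $e_j$. For all large integers $s$ one has $W(s,\mathbf e)=\sum_{j}W_j(s,\mathbf e)$, where $j$ runs over the positive divisors of the $e_i$ and the Sylvester wave $W_j(s,\mathbf e)$ is a sum $\sum_\rho\rho^sP_\rho(s)$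 over the primitive $j$-th roots of unity $\rho$ with polynomials $P_\rho$. The polynomial $W_1(s,\mathbf e)=P_1(s)$ is the polynomial part of $W(s,\mathbf e)$, considered for all real $s$. The Bernoulli polynomials and numbers of higher order are defined by $$e^{st}\prod_{j=1}^m\frac{e_jt}{e^{e_jt}-1}=\sum_{n\ge0}B^{(m)}_n(s,\mathbf e)\frac{t^n}{n!},\qquad B^{(m)}_n(\mathbf e)=B^{(m)}_n(0,\mathbf e).$$ Claim. For each $\mathbf e\in\{\mathbf d,\mathbf d_1,\dots,\mathbf d_m\}$ the polynomial part $W_1(\cdot,\mathbf e)$ exists, is unique and has real coefficients, and for all real $s$ $$W_1(s,\mathbf d)=\sum_{i=1}^mW_1(s\delta_i,\mathbf d_i).$$ Equivalently, since $W_1(s,\mathbf e)=\dfrac{B^{(m)}_{m-1}(s+\sigma_1(\mathbf e),\mathbf e)}{(m-1)!\,\pi(\mathbf e)}$ for all real $s$ and each $\mathbf e\in\{\mathbf d,\mathbf d_1,\dots,\mathbf d_m\}$, one has for all real $s$ $$\frac{B^{(m)}_{m-1}(s+\sigma_1(\mathbf d),\mathbf d)}{\pi(\mathbf d)}=\sum_{i=1}^m\frac{B^{(m)}_{m-1}(s\delta_i+\sigma_1(\mathbf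 d_i),\mathbf d_i)}{\pi(\mathbf d_i)},$$ and, for all integers $0\le k\le m-1$, $$\frac{B^{(m)}_{m-k-1}(\mathbf d)}{\pi(\mathbf d)}=\sum_{i=1}^m\frac{\delta_i^k\,B^{(m)}_{m-k-1}(\mathbf d_i)}{\pi(\mathbf d_i)}.$$ -/

import Mathlib

open Polynomial

/-- The number of solutions `x` in nonnegative integers of `∑ i, a i * x i = s`, for positive
generators `a i`. -/
noncomputable def partitionCount {m : ℕ} (a : Fin m → ℕ) (s : ℤ) : ℕ :=
  Nat.card {x : Fin m → ℕ // ∑ i, (a i : ℤ) * (x i : ℤ) = s}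

/-- The scalar partition function `W(s, d)` for nonzero integer generators. If all generators are
positive this is the number of solutions of `∑ i, d i * x i = s`. Each negative generator `-a` is
replaced by `a` by means of `1 / (1 - t ^ (-a)) = - t ^ a / (1 - t ^ a)`, so that
`W(s, d) = (-1) ^ K * W(s + ∑ (negative d i), |d|)`, `K` being the number of negative `d i`. -/
noncomputable def scalarPartition {m : ℕ} (d : Fin m → ℤ) (s : ℤ) : ℤ :=
  (-1) ^ (Finset.univ.filter fun i => d i < 0).card *
    (partitionCount (fun i => (d i).natAbs)
      (s + ∑ i ∈ Finset.univ.filter (fun i => d i < 0), d i) : ℤ)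

/-- The periods `j` of the Sylvester waves: all positive divisors of the generators. -/
def wavePeriods {m : ℕ} (d : Fin m → ℤ) : Finset ℕ :=
  Finset.univ.biUnion fun i => (d i).natAbs.divisors

/-- The polynomials `P ρ` give a decomposition of `W(s, d)` into Sylvester waves
`W_j(s, d) = ∑ ρ ^ s * P ρ (s)` (sum over the primitive `j`-th roots of unity `ρ`), where `j` runs
over the divisors of the generators. Agreement for all large `s` determines the waves. -/
def IsWaveDecomposition {m : ℕ} (d : Fin m → ℤ) (P : ℂ → ℂ[X]) : Prop :=
  ∀ᶠ s : ℕ in Filter.atTop, (scalarPartition d (s : ℤ) : ℂ) =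
    ∑ j ∈ wavePeriods d, ∑ ρ ∈ primitiveRoots j ℂ, ρ ^ s * (P ρ).eval (s : ℂ)

/-- `p` is the polynomial part of `W(s, d)`, that is, the wave of period `1`. -/
def IsPolynomialPart {m : ℕ} (d : Fin m → ℤ) (p : ℝ[X]) : Prop :=
  ∃ P : ℂ → ℂ[X], IsWaveDecomposition d P ∧ P 1 = p.map (algebraMap ℝ ℂ)

/-- The first Sylvester wave `W_1(s, d)`, as a function of a real argument `s`: the value at `s` of
the polynomial part of `W(·, d)`. -/
noncomputable def firstWave {m : ℕ} (d : Fin m → ℤ) (s : ℝ) : ℝ :=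
  (Classical.epsilon (IsPolynomialPart d)).eval s

/-- The power series `(e ^ (a t) - 1) / (a t)` in `t`. -/
noncomputable def expQuotient (a : ℝ) : PowerSeries ℝ :=
  PowerSeries.mk fun n => a ^ n / ((n + 1).factorial : ℝ)

/-- The generating function `e ^ (s t) * ∏ i, (d i) t / (e ^ ((d i) t) - 1)` of the Bernoulli
polynomials of higher order, as a power series in `t`. -/
noncomputable def higherBernoulliSeries {m : ℕ} (s : ℝ) (d : Fin m → ℝ) : PowerSeries ℝ :=
  PowerSeries.rescale s (PowerSeries.exp ℝ) * ∏ i, (expQuotient (d i))⁻¹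

/-- The Bernoulli polynomial of higher order `B^{(m)}_n(s, d)`: `n!` times the coefficient of `t ^ n`
in the generating function. -/
noncomputable def higherBernoulliPoly {m : ℕ} (n : ℕ) (s : ℝ) (d : Fin m → ℝ) : ℝ :=
  (n.factorial : ℝ) * PowerSeries.coeff n (higherBernoulliSeries s d)

/-- The Bernoulli number of higher order `B^{(m)}_n(d) = B^{(m)}_n(0, d)`. -/
noncomputable def higherBernoulliNumber {m : ℕ} (n : ℕ) (d : Fin m → ℝ) : ℝ :=
  higherBernoulliPoly n 0 d

theorem expQuotient_spec (a : ℝ) :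
    PowerSeries.C a * PowerSeries.X * expQuotient a =
      PowerSeries.rescale a (PowerSeries.exp ℝ) - 1 := by
  ext n
  rw [mul_assoc, PowerSeries.coeff_C_mul]
  cases n with
  | zero =>
    rw [PowerSeries.coeff_zero_X_mul, map_sub, PowerSeries.coeff_rescale, PowerSeries.coeff_exp]
    simp
  | succ n =>
    rw [PowerSeries.coeff_succ_X_mul]
    simp [expQuotient, PowerSeries.coeff_rescale, PowerSeries.coeff_exp, PowerSeries.coeff_one]
    ring

/-- The defining relation
`(∑ n, B^{(m)}_n(s, d) t ^ n / n!) * ∏ i, (e ^ ((d i) t) - 1) = e ^ (s t) * t ^ m * ∏ i, d i`. -/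
theorem higherBernoulliPoly_spec {m : ℕ} (s : ℝ) (d : Fin m → ℝ) :
    PowerSeries.mk (fun n => higherBernoulliPoly n s d / (n.factorial : ℝ)) *
        ∏ i, (PowerSeries.rescale (d i) (PowerSeries.exp ℝ) - 1) =
      PowerSeries.rescale s (PowerSeries.exp ℝ) * PowerSeries.X ^ m *
        PowerSeries.C (∏ i, d i) := by
  have h1 : PowerSeries.mk (fun n => higherBernoulliPoly n s d / (n.factorial : ℝ)) =
      higherBernoulliSeries s d := by
    ext n
    have : (n.factorial : ℝ) ≠ 0 := by positivity
    simp [higherBernoulliPoly, this]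
  have h2 : ∀ i, (expQuotient (d i))⁻¹ * expQuotient (d i) = 1 := fun i =>
    PowerSeries.inv_mul_cancel _ (by simp [expQuotient])
  have h3 : (∏ i, (expQuotient (d i))⁻¹) * ∏ i, expQuotient (d i) = 1 := by
    rw [← Finset.prod_mul_distrib]
    exact Finset.prod_eq_one fun i _ => h2 i
  rw [h1, higherBernoulliSeries]
  simp_rw [← expQuotient_spec]
  rw [Finset.prod_mul_distrib, Finset.prod_mul_distrib, ← map_prod]
  simp only [Finset.prod_const, Finset.card_univ, Fintype.card_fin]
  linear_combination (PowerSeries.rescale s (PowerSeries.exp ℝ) * PowerSeries.X ^ m *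
        PowerSeries.C (∏ i, d i)) * h3

/-- The vector `d_i` with `d_{i,i} = d_i` and `d_{i,j} = δ_i d_j - δ_j d_i` for `j ≠ i`. -/
def reducedGenerators {m : ℕ} (d δ : Fin m → ℤ) (i : Fin m) : Fin m → ℤ :=
  fun j => if j = i then d i else δ i * d j - δ j * d i

/-- The generators as real numbers. -/
def realGenerators {m : ℕ} (d : Fin m → ℤ) : Fin m → ℝ := fun i => (d i : ℝ)

/-- `σ_1(d)`, the sum of the generators. -/
noncomputable def generatorSum {m : ℕ} (d : Fin m → ℤ) : ℝ := ∑ i, (d i : ℝ)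

/-- `π(d)`, the product of the generators. -/
noncomputable def generatorProd {m : ℕ} (d : Fin m → ℤ) : ℝ := ∏ i, (d i : ℝ)

/-!
Let `φ(x) = x / (1 - e ^ (-x))` be the Todd series. The polynomial part of `W(s, e)` is the residue
at `t = 0` of `e ^ (s t) / ∏ i, (1 - e ^ (-e i t))`, that is, the coefficient of `t ^ (m - 1)` in
`e ^ (s t) ∏ i, φ(e i t) / e i`. Since `φ(x) = e ^ x * (x / (e ^ x - 1))`, this is the Bernoulli
polynomial `B^{(m)}_{m-1}(s + σ₁(e), e) / ((m - 1)! π(e))`.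

*The polynomial part is this residue.* For positive generators `a` and a common multiple `L` of
them, the generating function of the partition function is `H(x) / (1 - x ^ L) ^ m` with a
polynomial `H`, so for large `s` the value `W(s, a)` is a sum of binomial coefficients over the `k`
with `L ∣ s - k` (`partitionCount_eq_sum`). Detecting this divisibility by the `L`-th roots of unity
gives a sum of terms `ρ ^ s P ρ (s)`. Since a binomial coefficient is itself a coefficient of
`e ^ (s t) φ(t) ^ m` (`coeff_exp_mul_toddSeries_pow`), `P ρ` is identified with the residue of
`e ^ (s t) / ∏ i, (1 - ρ ^ (-a i) e ^ (-a i t))` (`eval_wavePoly`). It vanishes unless some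
`ρ ^ a i = 1`, because otherwise there is no pole. Negative generators are treated by the reflection
`φ(-x) = e ^ (-x) φ(x)`, and uniqueness holds because a quasi-polynomial that vanishes at all large
integers has no polynomial part (`eq_zero_of_eventually_sum_pow_mul_eval_eq_zero`).

*The relation.* Consider the two-variable function
`e ^ (s t) / ((1 - e ^ u) ∏ j, (1 - e ^ (-(d j t + δ j u))))`. Its residue at `u = 0` yields the term
for `d`, and its residue at `u = -d i t / δ i` yields the term for the generators `d_i`, after the
substitution of `δ i t` for `t`. The numerator of the part that matters is homogeneous of degree
`m - 1` and the denominator `u ∏ j, (d j t + δ j u)` has degree `m + 1`, so the sum of all residues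
in `u` is zero, by Lagrange interpolation. The argument works for every series `φ` with `φ(0) = 1`,
and with any series `g(t)` for `e ^ (s t)` (`coeff_mul_prod_rescale_div_eq_sum`). The relations
between the Bernoulli numbers are the case `g(t) = t ^ k`, `φ(x) = x / (e ^ x - 1)`.
-/

/-! ### Lagrange interpolation and the relation for general power series -/

/-- The sum of the residues of `P / ∏ i, (X - v i)` vanishes when `P` has degree at most
`card ι - 2`. -/
theorem sum_eval_div_prod_sub_eq_zero {K ι : Type*} [Field K] [Fintype ι] [DecidableEq ι]
    {v : ι → K} (hv : Function.Injective v) {P : K[X]} (hP : P.natDegree + 1 < Fintype.card ι) :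
    ∑ i, P.eval (v i) / ∏ j, (if j = i then 1 else v i - v j) = 0 := by
  have h := Lagrange.coeff_eq_sum (s := Finset.univ) (v := v) hv.injOn (P := P)
    (lt_of_le_of_lt degree_le_natDegree (by rw [Finset.card_univ]; exact_mod_cast by omega))
  rw [coeff_eq_zero_of_natDegree_lt (by rw [Finset.card_univ]; omega)] at h
  rw [h]
  refine Finset.sum_congr rfl fun i _ => ?_
  rw [← Finset.mul_prod_erase Finset.univ _ (Finset.mem_univ i), if_pos rfl, one_mul]
  congr 1
  exact Finset.prod_congr rfl fun j hj => if_neg (Finset.ne_of_mem_erase hj)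

/-- Power series over `R[X]` whose `n`-th coefficient has degree at most `n`. The
substitution of `u / t` for `X` turns them into power series in `t` and `u`. -/
def coeffNatDegreeLE (R : Type*) [CommRing R] : Submonoid (PowerSeries R[X]) where
  carrier := {f | ∀ n, (PowerSeries.coeff n f).natDegree ≤ n}
  one_mem' n := by
    rw [PowerSeries.coeff_one]
    split_ifs <;> simp
  mul_mem' {f g} hf hg n := by
    rw [PowerSeries.coeff_mul]
    refine natDegree_sum_le_of_forall_le _ _ fun p hp => natDegree_mul_le.trans ?_
    rw [← Finset.HasAntidiagonal.mem_antidiagonal.1 hp]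
    exact add_le_add (hf _) (hg _)

theorem map_C_mem_coeffNatDegreeLE {R : Type*} [CommRing R] (f : PowerSeries R) :
    PowerSeries.map C f ∈ coeffNatDegreeLE R := fun n => by simp

theorem rescale_map_C_mem_coeffNatDegreeLE {R : Type*} [CommRing R] {a : R[X]}
    (ha : a.natDegree ≤ 1) (f : PowerSeries R) :
    PowerSeries.rescale a (PowerSeries.map C f) ∈ coeffNatDegreeLE R := fun n => by
  rw [PowerSeries.coeff_rescale, PowerSeries.coeff_map]
  refine (natDegree_mul_C_le _ _).trans (natDegree_pow_le.trans ?_)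
  simpa using Nat.mul_le_mul_left n ha

theorem map_evalRingHom_rescale_map_C {R : Type*} [CommRing R] (u : R) (a : R[X])
    (f : PowerSeries R) :
    PowerSeries.map (evalRingHom u) (PowerSeries.rescale a (PowerSeries.map C f)) =
      PowerSeries.rescale (a.eval u) f := by
  ext n
  simp

/-- For all power series `g` and `φ` with `φ(0) = 1`, the coefficient of `t ^ (m - 1)` in
`g(t) ∏ j, φ(d j t) / d j` is the sum over `i` of the same coefficient for the series `g(δ i t)` and
the generators `d i` and `δ i * d j - δ j * d i`. -/
theorem coeff_mul_prod_rescale_div_eq_sum {K : Type*} [Field K] {m : ℕ} (hm : 1 ≤ m)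
    (d δ : Fin m → K) (hd : ∀ i, d i ≠ 0) (hδ : ∀ i, δ i ≠ 0)
    (hcol : ∀ i j, i ≠ j → δ i * d j ≠ δ j * d i) (g φ : PowerSeries K)
    (hφ : PowerSeries.constantCoeff φ = 1) :
    PowerSeries.coeff (m - 1) (g * ∏ j, PowerSeries.rescale (d j) φ) / ∏ j, d j =
      ∑ i, PowerSeries.coeff (m - 1) (PowerSeries.rescale (δ i) g *
        ∏ j, PowerSeries.rescale (if j = i then d i else δ i * d j - δ j * d i) φ) /
          ∏ j, (if j = i then d i else δ i * d j - δ j * d i) := by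
  -- Homogenize: `Φ(t, u) = g(t) φ(-u t) ∏ j, φ((d j + δ j u) t)`. The coefficient `P(u)` of
  -- `t ^ (m - 1)` is a polynomial, and the residues of `P(u) / (u ∏ j, (d j + δ j u))` sum to zero.
  set Φ : PowerSeries K[X] := PowerSeries.map C g *
    PowerSeries.rescale (-X) (PowerSeries.map C φ) *
      ∏ j, PowerSeries.rescale (C (d j) + C (δ j) * X) (PowerSeries.map C φ) with hΦ
  have hmem : Φ ∈ coeffNatDegreeLE K := by
    refine mul_mem (mul_mem (map_C_mem_coeffNatDegreeLE g)
      (rescale_map_C_mem_coeffNatDegreeLE (by simp) φ))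
      (prod_mem fun j _ => rescale_map_C_mem_coeffNatDegreeLE ?_ φ)
    exact (natDegree_add_le _ _).trans (by simpa using natDegree_C_mul_le (δ j) X |>.trans (by simp))
  set P : K[X] := PowerSeries.coeff (m - 1) Φ
  have heval (u : K) : P.eval u = PowerSeries.coeff (m - 1) (g * PowerSeries.rescale (-u) φ *
      ∏ j, PowerSeries.rescale (d j + δ j * u) φ) := by
    have : P.eval u = PowerSeries.coeff (m - 1) (PowerSeries.map (evalRingHom u) Φ) := by
      rw [PowerSeries.coeff_map, coe_evalRingHom]
    rw [this, hΦ, map_mul (PowerSeries.map _), map_mul (PowerSeries.map _), map_prod]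
    simp only [map_evalRingHom_rescale_map_C]
    have hg : PowerSeries.map (evalRingHom u) (PowerSeries.map C g) = g := by ext n; simp
    simp [hg]
  have hφ0 : PowerSeries.rescale 0 φ = 1 := by simp [hφ]
  have heval0 : P.eval 0 = PowerSeries.coeff (m - 1) (g * ∏ j, PowerSeries.rescale (d j) φ) := by
    simp [heval, hφ]
  have hevali (i : Fin m) : PowerSeries.coeff (m - 1) (PowerSeries.rescale (δ i) g *
        ∏ j, PowerSeries.rescale (if j = i then d i else δ i * d j - δ j * d i) φ) =
      δ i ^ (m - 1) * P.eval (-(d i / δ i)) := by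
    rw [heval, ← PowerSeries.coeff_rescale, map_mul (PowerSeries.rescale _),
      map_mul (PowerSeries.rescale _), map_prod, mul_assoc]
    simp only [PowerSeries.rescale_rescale]
    congr 2
    rw [← Finset.mul_prod_erase Finset.univ _ (Finset.mem_univ i),
      ← Finset.mul_prod_erase Finset.univ (fun j =>
        PowerSeries.rescale ((d j + δ j * -(d i / δ i)) * δ i) φ) (Finset.mem_univ i), if_pos rfl]
    have h1 : (d i + δ i * -(d i / δ i)) * δ i = 0 := by field_simp [hδ i]; simp
    have h2 : - -(d i / δ i) * δ i = d i := by field_simp [hδ i]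
    rw [h1, h2, hφ0, one_mul]
    congr 1
    refine Finset.prod_congr rfl fun j hj => ?_
    rw [if_neg (Finset.ne_of_mem_erase hj)]
    congr 1
    congr 1
    field_simp [hδ i]
    ring
  have hinj : Function.Injective (fun o : Option (Fin m) => o.elim 0 fun i => -(d i / δ i)) := by
    rintro (_ | i) (_ | j) h
    · rfl
    · exact absurd h.symm (neg_ne_zero.2 (div_ne_zero (hd j) (hδ j)))
    · exact absurd h (neg_ne_zero.2 (div_ne_zero (hd i) (hδ i)))
    · by_contra hne
      have h' : d i / δ i = d j / δ j := neg_injective h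
      rw [div_eq_div_iff (hδ i) (hδ j)] at h'
      exact hcol i j (fun h => hne (h ▸ rfl)) (by linear_combination -h')
  have hsum := sum_eval_div_prod_sub_eq_zero hinj (P := P) (by
    have : P.natDegree ≤ m - 1 := hmem (m - 1)
    rw [Fintype.card_option, Fintype.card_fin]
    omega)
  simp only [Fintype.sum_option, Fintype.prod_option, Option.elim_none, Option.elim_some,
    Option.some_inj, if_true, reduceCtorEq, if_false, one_mul, heval0, zero_sub, neg_neg,
    sub_zero] at hsum
  have hδp : ∏ j, δ j ≠ 0 := Finset.prod_ne_zero_iff.2 fun j _ => hδ j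
  have hprod (i : Fin m) : -(d i / δ i) *
      ∏ j, (if j = i then 1 else -(d i / δ i) - -(d j / δ j)) =
        -((∏ j, (if j = i then d i else δ i * d j - δ j * d i)) / (δ i ^ (m - 1) * ∏ j, δ j)) := by
    have hf (j : Fin m) : (if j = i then 1 else -(d i / δ i) - -(d j / δ j)) =
        (if j = i then d i else δ i * d j - δ j * d i) / (δ i * δ j) *
          (if j = i then δ i ^ 2 / d i else 1) := by
      split_ifs with h
      · subst h; field_simp [hδ j, hd j]
      · field_simp [hδ i, hδ j]; ring
    simp only [hf]
    rw [Finset.prod_mul_distrib, Finset.prod_div_distrib, Finset.prod_mul_distrib]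
    obtain ⟨n, rfl⟩ : ∃ n, m = n + 1 := ⟨m - 1, by omega⟩
    simp only [Finset.prod_ite_eq', Finset.mem_univ, if_true, Finset.prod_const, Finset.card_univ,
      Fintype.card_fin, Nat.add_sub_cancel]
    field_simp [hδ i, hd i]
    ring
  simp only [hprod, Finset.prod_div_distrib] at hsum
  rw [← mul_right_inj' hδp, ← sub_eq_zero, ← hsum, Finset.mul_sum, sub_eq_add_neg,
    ← Finset.sum_neg_distrib]
  congr 1
  · field_simp
  · refine Finset.sum_congr rfl fun i _ => ?_
    rw [hevali, div_neg, neg_inj, div_div_eq_mul_div]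
    ring

/-! ### The Todd series -/

/-- The power series `X / (1 - e ^ (-X))`. -/
noncomputable def toddSeries (K : Type*) [Field K] [CharZero K] : PowerSeries K :=
  bernoulli'PowerSeries K

/-- The polynomial in `s` that is the coefficient of `t ^ n` in `e ^ (s t) Θ(t)`. -/
noncomputable def expMulCoeff {K : Type*} [Field K] (n : ℕ) (Θ : PowerSeries K) : K[X] :=
  ∑ p ∈ Finset.HasAntidiagonal.antidiagonal n,
    monomial p.1 (PowerSeries.coeff p.2 Θ / (p.1.factorial : K))

theorem map_expMulCoeff {K L : Type*} [Field K] [Field L] (f : K →+* L) (n : ℕ)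
    (Θ : PowerSeries K) :
    (expMulCoeff n Θ).map f = expMulCoeff n (PowerSeries.map f Θ) := by
  simp [expMulCoeff, Polynomial.map_sum]

section Todd

variable {K : Type*} [Field K] [CharZero K]

theorem exp_sub_one_ne_zero : PowerSeries.exp K - 1 ≠ 0 := fun h => by
  simpa using congrArg (PowerSeries.coeff 1) h

theorem rescale_exp_mul_rescale_neg_exp (a : K) :
    PowerSeries.rescale a (PowerSeries.exp K) * PowerSeries.rescale (-a) (PowerSeries.exp K) =
      1 := by
  rw [PowerSeries.exp_mul_exp_eq_exp_add, add_neg_cancel]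
  simp

theorem toddSeries_mul_one_sub_exp_neg :
    toddSeries K * (1 - PowerSeries.rescale (-1) (PowerSeries.exp K)) = PowerSeries.X := by
  have h1 := bernoulli'PowerSeries_mul_exp_sub_one K
  have h2 := rescale_exp_mul_rescale_neg_exp (1 : K)
  rw [PowerSeries.rescale_one, RingHom.id_apply] at h2
  rw [toddSeries]
  linear_combination PowerSeries.rescale (-1 : K) (PowerSeries.exp K) * h1 -
    (bernoulli'PowerSeries K - PowerSeries.X) * h2

theorem constantCoeff_toddSeries : PowerSeries.constantCoeff (toddSeries K) = 1 := by
  simp [toddSeries, bernoulli'PowerSeries, ← PowerSeries.coeff_zero_eq_constantCoeff_apply]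

theorem constantCoeff_bernoulliPowerSeries :
    PowerSeries.constantCoeff (bernoulliPowerSeries K) = 1 := by
  simp [bernoulliPowerSeries, ← PowerSeries.coeff_zero_eq_constantCoeff_apply]

theorem toddSeries_eq_exp_mul_bernoulliPowerSeries :
    toddSeries K = PowerSeries.exp K * bernoulliPowerSeries K := by
  refine mul_right_cancel₀ (exp_sub_one_ne_zero (K := K)) ?_
  rw [toddSeries, bernoulli'PowerSeries_mul_exp_sub_one, mul_assoc,
    bernoulliPowerSeries_mul_exp_sub_one, mul_comm]

theorem map_toddSeries {L : Type*} [Field L] [CharZero L] (f : K →+* L) :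
    PowerSeries.map f (toddSeries K) = toddSeries L := by
  ext n
  simp [toddSeries, bernoulli'PowerSeries]

theorem rescale_toddSeries_mul_one_sub_exp_neg (a : K) :
    PowerSeries.rescale a (toddSeries K) *
      (1 - PowerSeries.rescale (-a) (PowerSeries.exp K)) = PowerSeries.C a * PowerSeries.X := by
  have h := congrArg (PowerSeries.rescale a) (toddSeries_mul_one_sub_exp_neg (K := K))
  rwa [map_mul, map_sub, map_one, PowerSeries.rescale_rescale, neg_one_mul,
    PowerSeries.rescale_X] at h

/-- The reflection `φ(-x) = e ^ (-x) φ(x)` of the Todd series `φ`. -/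
theorem rescale_neg_toddSeries (a : K) :
    PowerSeries.rescale (-a) (toddSeries K) =
      PowerSeries.rescale (-a) (PowerSeries.exp K) * PowerSeries.rescale a (toddSeries K) := by
  have key : PowerSeries.rescale (-1) (toddSeries K) =
      PowerSeries.rescale (-1) (PowerSeries.exp K) * toddSeries K := by
    have h1 := bernoulli'PowerSeries_mul_exp_sub_one K
    have h2 := rescale_toddSeries_mul_one_sub_exp_neg (-1 : K)
    have h3 := rescale_exp_mul_rescale_neg_exp (1 : K)
    rw [PowerSeries.rescale_one, RingHom.id_apply] at h3
    rw [neg_neg, PowerSeries.rescale_one, RingHom.id_apply] at h2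
    refine mul_right_cancel₀ (exp_sub_one_ne_zero (K := K)) ?_
    rw [toddSeries] at h2 ⊢
    simp only [map_neg, map_one] at h2
    linear_combination -h2 - PowerSeries.rescale (-1 : K) (PowerSeries.exp K) * h1 -
      PowerSeries.X * h3
  have h := congrArg (PowerSeries.rescale a) key
  rwa [map_mul, PowerSeries.rescale_rescale, PowerSeries.rescale_rescale, neg_one_mul] at h

theorem eval_expMulCoeff (n : ℕ) (Θ : PowerSeries K) (s : K) :
    (expMulCoeff n Θ).eval s =
      PowerSeries.coeff n (PowerSeries.rescale s (PowerSeries.exp K) * Θ) := by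
  rw [expMulCoeff, eval_finsetSum, PowerSeries.coeff_mul]
  refine Finset.sum_congr rfl fun p _ => ?_
  rw [eval_monomial, PowerSeries.coeff_rescale, PowerSeries.coeff_exp]
  simp
  ring

/-- Formally, `e ^ (-t) (t / (1 - e ^ (-t))) ^ (n + 2) = t ^ (n + 2) u' / u ^ (n + 2)` with
`u = 1 - e ^ (-t)`, and `u' / u ^ (n + 2)` is a derivative, so it has no residue. -/
theorem coeff_exp_neg_mul_toddSeries_pow (n : ℕ) :
    PowerSeries.coeff (n + 1) (PowerSeries.rescale (-1) (PowerSeries.exp K) *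
      toddSeries K ^ (n + 2)) = 0 := by
  set T := toddSeries K with hT
  set E := PowerSeries.rescale (-1 : K) (PowerSeries.exp K) with hE
  have h : T * (1 - E) = PowerSeries.X := toddSeries_mul_one_sub_exp_neg
  have hdE : PowerSeries.derivative K E = -E := by
    ext k
    rw [hE, PowerSeries.coeff_derivative, map_neg, PowerSeries.coeff_rescale,
      PowerSeries.coeff_rescale, PowerSeries.coeff_exp, PowerSeries.coeff_exp, Nat.factorial_succ]
    have : ((k : K) + 1) ≠ 0 := by exact_mod_cast Nat.succ_ne_zero k
    simp
    field_simp
    ring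
  have hd : T * E + (1 - E) * PowerSeries.derivative K T = 1 := by
    have := congrArg (PowerSeries.derivative K) h
    rw [Derivation.leibniz, map_sub, hdE, PowerSeries.derivative_one,
      PowerSeries.derivative_X] at this
    simpa [smul_eq_mul] using this
  have key : ((n : PowerSeries K) + 1) * (E * T ^ (n + 2)) =
      ((n : PowerSeries K) + 1) * T ^ (n + 1) -
        PowerSeries.X * PowerSeries.derivative K (T ^ (n + 1)) := by
    rw [PowerSeries.derivative_pow, Nat.add_sub_cancel, ← h]
    push_cast
    linear_combination ((n : PowerSeries K) + 1) * T ^ (n + 1) * hd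
  have h2 := congrArg (PowerSeries.coeff (n + 1)) key
  have hc : (n : PowerSeries K) + 1 = PowerSeries.C ((n : K) + 1) := by simp
  rw [map_sub, hc, PowerSeries.coeff_C_mul, PowerSeries.coeff_C_mul, PowerSeries.coeff_succ_X_mul,
    PowerSeries.coeff_derivative, mul_comm (PowerSeries.coeff (n + 1) (T ^ (n + 1))), sub_self] at h2
  exact (mul_eq_zero.1 h2).resolve_left (by exact_mod_cast Nat.succ_ne_zero n)

/-- The partition function with `n + 1` generators equal to `1` is the residue at `t = 0` of
`e ^ (s t) / (1 - e ^ (-t)) ^ (n + 1)`. -/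
theorem coeff_exp_mul_toddSeries_pow (n s : ℕ) :
    PowerSeries.coeff n (PowerSeries.rescale (s : K) (PowerSeries.exp K) *
      toddSeries K ^ (n + 1)) = ((n + s).choose n : K) := by
  -- Both sides satisfy the recurrence of Pascal's triangle.
  have hstep (n : ℕ) (s : K) : PowerSeries.coeff (n + 1)
      (PowerSeries.rescale s (PowerSeries.exp K) * toddSeries K ^ (n + 2)) =
        PowerSeries.coeff n
          (PowerSeries.rescale s (PowerSeries.exp K) * toddSeries K ^ (n + 1)) +
        PowerSeries.coeff (n + 1)
          (PowerSeries.rescale (s - 1) (PowerSeries.exp K) * toddSeries K ^ (n + 2)) := by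
    rw [← PowerSeries.coeff_succ_X_mul n, ← map_add]
    congr 1
    rw [sub_eq_add_neg, ← PowerSeries.exp_mul_exp_eq_exp_add,
      ← toddSeries_mul_one_sub_exp_neg]
    ring
  induction n generalizing s with
  | zero =>
    simp [constantCoeff_toddSeries,
      ← PowerSeries.coeff_zero_eq_constantCoeff_apply (PowerSeries.rescale _ _)]
  | succ n ihn =>
    induction s with
    | zero =>
      rw [hstep, Nat.cast_zero, zero_sub, coeff_exp_neg_mul_toddSeries_pow, add_zero,
        ← Nat.cast_zero, ihn]
      simp
    | succ s ihs =>
      rw [hstep, ihn, Nat.cast_succ, add_sub_cancel_right, ihs, ← Nat.cast_add]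
      congr 1
      rw [show n + 1 + (s + 1) = (n + s + 1) + 1 by ring, Nat.choose_succ_succ]
      congr 2; ring

end Todd

/-! ### The generating function of the partition function -/

theorem partitionCount_eq_coeff (R : Type*) [CommRing R] {m : ℕ} {a : Fin m → ℕ}
    (ha : ∀ i, a i ≠ 0) (s : ℕ) :
    (partitionCount a (s : ℤ) : R) = PowerSeries.coeff s
      (∏ i, PowerSeries.expand (a i) (ha i) (PowerSeries.mk 1 : PowerSeries R)) := by
  classical
  rw [PowerSeries.coeff_prod]
  simp only [PowerSeries.coeff_expand, PowerSeries.coeff_mk, Pi.one_apply, Finset.prod_ite_zero,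
    Finset.prod_const_one, Finset.sum_boole, Finset.mem_univ, true_implies]
  congr 1
  rw [partitionCount, ← Fintype.card_coe, ← Nat.card_eq_fintype_card]
  refine Nat.card_congr
    { toFun := fun x => ⟨Finsupp.equivFunOnFinite.symm fun i => a i * x.1 i, ?_⟩
      invFun := fun l => ⟨fun i => l.1 i / a i, ?_⟩
      left_inv := fun x => ?_
      right_inv := fun l => ?_ }
  · have hx : ∑ i, a i * x.1 i = s := by exact_mod_cast x.2
    simp [Finset.mem_filter, Finset.mem_finsuppAntidiag, hx]
  · have hl := (Finset.mem_filter.1 l.2)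
    have h1 : ∑ i, l.1 i = s := (Finset.mem_finsuppAntidiag.1 hl.1).1
    have h2 (i : Fin m) : a i * (l.1 i / a i) = l.1 i := Nat.mul_div_cancel' (hl.2 i)
    exact_mod_cast (Finset.sum_congr rfl fun i _ => h2 i).trans h1
  · ext i
    simp [Nat.mul_div_cancel_left _ (Nat.pos_of_ne_zero (ha i))]
  · have hl := (Finset.mem_filter.1 l.2)
    ext i
    simpa using Nat.mul_div_cancel' (hl.2 i)

/-- The numerator `∏ i, (1 - X ^ L) / (1 - X ^ (a i))` of the generating function of the partition
function over the denominator `(1 - X ^ L) ^ m`, for a common multiple `L` of the generators. -/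
noncomputable def partitionNumerator {m : ℕ} (R : Type*) [CommRing R] (L : ℕ) (a : Fin m → ℕ) :
    R[X] :=
  ∏ i, ∑ k ∈ Finset.range (L / a i), (X ^ a i) ^ k

theorem partitionNumerator_mul_prod {R : Type*} [CommRing R] {m L : ℕ} {a : Fin m → ℕ}
    (hL : ∀ i, a i ∣ L) :
    partitionNumerator R L a * ∏ i, (1 - X ^ a i) = (1 - X ^ L) ^ m := by
  rw [partitionNumerator, ← Finset.prod_mul_distrib]
  have (i : Fin m) : (∑ k ∈ Finset.range (L / a i), (X ^ a i : R[X]) ^ k) * (1 - X ^ a i) =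
      1 - X ^ L := by
    rw [geom_sum_mul_neg, ← pow_mul, Nat.mul_div_cancel' (hL i)]
  simp [this]

theorem expand_mk_one_mul {R : Type*} [CommRing R] {a : ℕ} (ha : a ≠ 0) :
    PowerSeries.expand a ha (PowerSeries.mk 1 : PowerSeries R) * (1 - PowerSeries.X ^ a) = 1 := by
  have := congrArg (PowerSeries.expand a ha) (PowerSeries.mk_one_mul_one_sub_eq_one R)
  simpa using this

theorem partitionCount_eq_sum (R : Type*) [CommRing R] {n L : ℕ} {a : Fin (n + 1) → ℕ}
    (ha : ∀ i, a i ≠ 0) (hL0 : L ≠ 0) (hL : ∀ i, a i ∣ L) (s : ℕ) :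
    (partitionCount a (s : ℤ) : R) = ∑ k ∈ Finset.range (s + 1),
      (partitionNumerator R L a).coeff k *
        if L ∣ s - k then ((n + (s - k) / L).choose n : R) else 0 := by
  have hF : (∏ i, PowerSeries.expand (a i) (ha i) (PowerSeries.mk 1 : PowerSeries R)) *
      ∏ i, (1 - PowerSeries.X ^ a i) = 1 := by
    rw [← Finset.prod_mul_distrib]
    exact Finset.prod_eq_one fun i _ => expand_mk_one_mul (ha i)
  have hH : (partitionNumerator R L a : PowerSeries R) * ∏ i, (1 - PowerSeries.X ^ a i) =
      (1 - PowerSeries.X ^ L) ^ (n + 1) := by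
    have := congrArg (coeToPowerSeries.ringHom (R := R))
      (partitionNumerator_mul_prod (R := R) hL)
    rw [map_mul, map_prod] at this
    simpa using this
  have hG : PowerSeries.expand L hL0
      (PowerSeries.mk fun k => ((n + k).choose n : R)) * (1 - PowerSeries.X ^ L) ^ (n + 1) = 1 := by
    have := congrArg (PowerSeries.expand L hL0)
      (PowerSeries.mk_add_choose_mul_one_sub_pow_eq_one R n)
    simpa using this
  have key : ∏ i, PowerSeries.expand (a i) (ha i) (PowerSeries.mk 1 : PowerSeries R) =
      (partitionNumerator R L a : PowerSeries R) * PowerSeries.expand L hL0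
        (PowerSeries.mk fun k => ((n + k).choose n : R)) := by
    set F := ∏ i, PowerSeries.expand (a i) (ha i) (PowerSeries.mk 1 : PowerSeries R)
    set G := PowerSeries.expand L hL0 (PowerSeries.mk fun k => ((n + k).choose n : R))
    linear_combination (G * partitionNumerator R L a) * hF - F * G * hH - F * hG
  rw [partitionCount_eq_coeff R ha, key, PowerSeries.coeff_mul,
    Finset.Nat.sum_antidiagonal_eq_sum_range_succ_mk]
  simp only [Polynomial.coeff_coe, PowerSeries.coeff_expand, PowerSeries.coeff_mk]

/-! ### Power sums of roots of unity and uniqueness of the polynomial part -/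

theorem sum_nthRootsFinset_pow {L : ℕ} (hL : L ≠ 0) (k : ℕ) :
    ∑ ρ ∈ nthRootsFinset L (1 : ℂ), ρ ^ k = if L ∣ k then (L : ℂ) else 0 := by
  have hLpos := Nat.pos_of_ne_zero hL
  have hζ := Complex.isPrimitiveRoot_exp L hL
  set ζ := Complex.exp (2 * Real.pi * Complex.I / L)
  split_ifs with h
  · obtain ⟨q, rfl⟩ := h
    rw [Finset.sum_congr rfl (g := fun _ => (1 : ℂ)) fun ρ hρ => by
      rw [pow_mul, (mem_nthRootsFinset hLpos 1).1 hρ, one_pow]]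
    simp [hζ.card_nthRootsFinset]
  · have hinv : ζ ^ L = 1 := hζ.pow_eq_one
    have hζ0 : ζ ≠ 0 := hζ.ne_zero hL
    -- Multiplication by `ζ` permutes the roots and multiplies the sum by `ζ ^ k`.
    have hperm : ∑ ρ ∈ nthRootsFinset L (1 : ℂ), ρ ^ k =
        ∑ ρ ∈ nthRootsFinset L (1 : ℂ), (ζ * ρ) ^ k := by
      symm
      refine Finset.sum_nbij' (fun ρ => ζ * ρ) (fun ρ => ζ⁻¹ * ρ) ?_ ?_ ?_ ?_ ?_
      · intro ρ hρ
        rw [mem_nthRootsFinset hLpos] at hρ ⊢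
        rw [mul_pow, hinv, hρ, one_mul]
      · intro ρ hρ
        rw [mem_nthRootsFinset hLpos] at hρ ⊢
        rw [mul_pow, inv_pow, hinv, hρ, inv_one, one_mul]
      · intro ρ _
        exact inv_mul_cancel_left₀ hζ0 ρ
      · intro ρ _
        exact mul_inv_cancel_left₀ hζ0 ρ
      · intro ρ _
        rfl
    simp only [mul_pow, ← Finset.mul_sum] at hperm
    have h1 : ζ ^ k ≠ 1 := fun h1 => h (hζ.dvd_of_pow_eq_one k h1)
    have : (ζ ^ k - 1) * ∑ ρ ∈ nthRootsFinset L (1 : ℂ), ρ ^ k = 0 := by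
      linear_combination -hperm
    exact (mul_eq_zero.1 this).resolve_left (sub_ne_zero.2 h1)

/-- If a quasi-polynomial vanishes at all large integers, its polynomial part is zero. -/
theorem eq_zero_of_eventually_sum_pow_mul_eval_eq_zero {S : Finset ℂ} {L : ℕ} (hL : L ≠ 0)
    (hS : ∀ ρ ∈ S, ρ ^ L = 1) (h1 : (1 : ℂ) ∈ S) {Q : ℂ → ℂ[X]}
    (hQ : ∀ᶠ s : ℕ in Filter.atTop, ∑ ρ ∈ S, ρ ^ s * (Q ρ).eval (s : ℂ) = 0) : Q 1 = 0 := by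
  -- On a residue class modulo `L` the sum is polynomial, hence vanishes identically.
  have hR (r : ℕ) : ∑ ρ ∈ S, C (ρ ^ r) * Q ρ = 0 := by
    obtain ⟨N, hN⟩ := Filter.eventually_atTop.1 hQ
    refine eq_zero_of_infinite_isRoot _ (Set.Infinite.mono (s := Set.range fun n : ℕ =>
      ((L * (n + N) + r : ℕ) : ℂ)) ?_ (Set.infinite_range_of_injective ?_))
    · rintro _ ⟨n, rfl⟩
      have h := hN (L * (n + N) + r) (by
        have := Nat.le_mul_of_pos_left (n + N) (Nat.pos_of_ne_zero hL)
        omega)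
      rw [Set.mem_ofPred_eq, IsRoot.def, eval_finsetSum, ← h]
      refine Finset.sum_congr rfl fun ρ hρ => ?_
      rw [eval_mul, eval_C, pow_add, pow_mul, hS ρ hρ, one_pow, one_mul]
    · intro n n' h
      have h' : L * (n + N) + r = L * (n' + N) + r := Nat.cast_injective h
      have := Nat.eq_of_mul_eq_mul_left (Nat.pos_of_ne_zero hL) (Nat.add_right_cancel h')
      omega
  have hsum : ∑ r ∈ Finset.range L, ∑ ρ ∈ S, C (ρ ^ r) * Q ρ = C (L : ℂ) * Q 1 := by
    rw [Finset.sum_comm, Finset.sum_eq_single_of_mem 1 h1]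
    · simp
    · intro ρ hρ hne
      rw [← Finset.sum_mul, ← map_sum]
      have : (∑ r ∈ Finset.range L, ρ ^ r) * (ρ - 1) = 0 := by
        rw [geom_sum_mul, hS ρ hρ, sub_self]
      rw [(mul_eq_zero.1 this).resolve_right (sub_ne_zero.2 hne), C_0, zero_mul]
  rw [Finset.sum_eq_zero fun r _ => hR r] at hsum
  exact (mul_eq_zero.1 hsum.symm).resolve_left (by simpa using hL)

/-! ### The Sylvester waves -/

/-- The power series `t / (1 - ρ ^ (-a) e ^ (-a t))`: it is `φ (a t) / a` with `φ` the Todd series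
if `ρ ^ a = 1` (and `a ≠ 0`), and otherwise `t` times an invertible series. -/
noncomputable def waveFactor (ρ : ℂ) (a : ℕ) : PowerSeries ℂ :=
  if ρ ^ a = 1 then PowerSeries.C (a : ℂ)⁻¹ * PowerSeries.rescale (a : ℂ) (toddSeries ℂ)
  else PowerSeries.X *
    (1 - PowerSeries.C (ρ⁻¹ ^ a) * PowerSeries.rescale (-a : ℂ) (PowerSeries.exp ℂ))⁻¹

theorem waveFactor_mul {ρ : ℂ} {a : ℕ} (ha : a ≠ 0) :
    waveFactor ρ a *
      (1 - PowerSeries.C (ρ⁻¹ ^ a) * PowerSeries.rescale (-a : ℂ) (PowerSeries.exp ℂ)) =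
        PowerSeries.X := by
  rw [waveFactor]
  split_ifs with h
  · rw [inv_pow, h, inv_one, map_one, one_mul, mul_assoc, rescale_toddSeries_mul_one_sub_exp_neg,
      ← mul_assoc, ← map_mul, inv_mul_cancel₀ (Nat.cast_ne_zero.2 ha), map_one, one_mul]
  · rw [mul_assoc, PowerSeries.inv_mul_cancel, mul_one]
    have hE : PowerSeries.constantCoeff (PowerSeries.rescale (-a : ℂ) (PowerSeries.exp ℂ)) = 1 := by
      simp [← PowerSeries.coeff_zero_eq_constantCoeff_apply]
    rw [map_sub, map_one, map_mul, PowerSeries.constantCoeff_C, hE, mul_one, sub_ne_zero, inv_pow,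
      ne_comm, Ne, inv_eq_one]
    exact h

/-- The polynomial `P ρ` of the Sylvester wave decomposition for positive generators `a`:
its value at `s` is the residue at `t = 0` of `e ^ (s t) / ∏ i, (1 - ρ ^ (-a i) e ^ (-a i t))`. -/
noncomputable def wavePoly {m : ℕ} (a : Fin m → ℕ) (ρ : ℂ) : ℂ[X] :=
  expMulCoeff (m - 1) (∏ i, waveFactor ρ (a i))

theorem wavePoly_eq_zero {m : ℕ} (hm : 1 ≤ m) {a : Fin m → ℕ} {ρ : ℂ} (h : ∀ i, ρ ^ a i ≠ 1) :
    wavePoly a ρ = 0 := by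
  refine funext fun s => ?_
  rw [wavePoly, eval_expMulCoeff, eval_zero]
  have hX : PowerSeries.X ^ m ∣ ∏ i, waveFactor ρ (a i) := by
    have : ∏ _i : Fin m, (PowerSeries.X : PowerSeries ℂ) ∣ ∏ i, waveFactor ρ (a i) :=
      Finset.prod_dvd_prod_of_dvd _ _ fun i _ => by
        rw [waveFactor, if_neg (h i)]
        exact dvd_mul_right _ _
    simpa using this
  exact PowerSeries.X_pow_dvd_iff.1 (hX.mul_left _) (m - 1) (by omega)

/-- For an `L`-th root of unity `ρ`, the value of `wavePoly a ρ` as a combination of values of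
the polynomial part for `n + 1` generators equal to `1`. -/
theorem eval_wavePoly {n L : ℕ} {a : Fin (n + 1) → ℕ} (ha : ∀ i, a i ≠ 0) (hL0 : L ≠ 0)
    (hL : ∀ i, a i ∣ L) {ρ : ℂ} (hρ : ρ ^ L = 1) {N : ℕ}
    (hN : (partitionNumerator ℂ L a).natDegree < N) (s : ℂ) :
    (L : ℂ) * (wavePoly a ρ).eval s = ∑ k ∈ Finset.range N, (partitionNumerator ℂ L a).coeff k *
      ρ⁻¹ ^ k * PowerSeries.coeff n (PowerSeries.rescale ((s - k) / L) (PowerSeries.exp ℂ) *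
        toddSeries ℂ ^ (n + 1)) := by
  have hL0' : (L : ℂ) ≠ 0 := Nat.cast_ne_zero.2 hL0
  set y : PowerSeries ℂ := PowerSeries.C ρ⁻¹ * PowerSeries.rescale (-1) (PowerSeries.exp ℂ) with hy
  have hypow (k : ℕ) : y ^ k =
      PowerSeries.C (ρ⁻¹ ^ k) * PowerSeries.rescale (-k : ℂ) (PowerSeries.exp ℂ) := by
    rw [hy, mul_pow, ← map_pow, ← map_pow, PowerSeries.exp_pow_eq_rescale_exp,
      PowerSeries.rescale_rescale, mul_neg_one]
  set T : PowerSeries ℂ := PowerSeries.rescale (L : ℂ) (toddSeries ℂ) with hT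
  have hTy : T * (1 - y ^ L) = PowerSeries.C (L : ℂ) * PowerSeries.X := by
    rw [hypow, inv_pow, hρ, inv_one, map_one, one_mul, hT, rescale_toddSeries_mul_one_sub_exp_neg]
  have hW : (∏ i, waveFactor ρ (a i)) * ∏ i, (1 - y ^ a i) = PowerSeries.X ^ (n + 1) := by
    rw [← Finset.prod_mul_distrib, Finset.prod_congr rfl fun i _ => by
      rw [hypow, waveFactor_mul (ha i)]]
    simp
  have hH : aeval y (partitionNumerator ℂ L a) * ∏ i, (1 - y ^ a i) = (1 - y ^ L) ^ (n + 1) := by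
    have := congrArg (aeval y) (partitionNumerator_mul_prod (R := ℂ) hL)
    rw [map_mul, map_prod] at this
    simpa using this
  -- The numerator at `y = ρ⁻¹ e ^ (-t)` clears the denominators of the wave.
  have key : PowerSeries.C ((L : ℂ) ^ (n + 1)) * ∏ i, waveFactor ρ (a i) =
      aeval y (partitionNumerator ℂ L a) * T ^ (n + 1) := by
    have hne : ∏ i, (1 - y ^ a i) ≠ 0 := fun h0 => by
      rw [h0, mul_zero] at hW
      exact pow_ne_zero _ PowerSeries.X_ne_zero hW.symm
    refine mul_right_cancel₀ hne ?_
    rw [mul_assoc, hW, mul_right_comm, hH, ← mul_pow, mul_comm (1 - y ^ L), hTy, mul_pow, map_pow]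
  have hexp (k : ℕ) : PowerSeries.rescale s (PowerSeries.exp ℂ) *
      (((partitionNumerator ℂ L a).coeff k • y ^ k) * T ^ (n + 1)) =
      PowerSeries.C ((partitionNumerator ℂ L a).coeff k * ρ⁻¹ ^ k) * PowerSeries.rescale (L : ℂ)
        (PowerSeries.rescale ((s - k) / L) (PowerSeries.exp ℂ) * toddSeries ℂ ^ (n + 1)) := by
    rw [hypow, map_mul (PowerSeries.rescale _), PowerSeries.rescale_rescale,
      div_mul_cancel₀ _ hL0', sub_eq_add_neg, ← PowerSeries.exp_mul_exp_eq_exp_add,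
      map_pow (PowerSeries.rescale _),
      PowerSeries.smul_eq_C_mul, map_mul PowerSeries.C]
    ring
  have hmain := congrArg (fun f => PowerSeries.coeff n
    (PowerSeries.rescale s (PowerSeries.exp ℂ) * f)) key
  beta_reduce at hmain
  rw [mul_left_comm, PowerSeries.coeff_C_mul, aeval_eq_sum_range' hN, Finset.sum_mul,
    Finset.mul_sum, map_sum] at hmain
  simp only [hexp, PowerSeries.coeff_C_mul, PowerSeries.coeff_rescale] at hmain
  rw [wavePoly, eval_expMulCoeff, Nat.add_sub_cancel]
  refine mul_left_cancel₀ (pow_ne_zero n hL0') ?_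
  rw [← mul_assoc, ← pow_succ, hmain, Finset.mul_sum]
  exact Finset.sum_congr rfl fun k _ => by ring

/-- For positive generators, the partition function is the sum of its waves at all large integers. -/
theorem partitionCount_eq_sum_wavePoly {m L : ℕ} (hm : 1 ≤ m) {a : Fin m → ℕ}
    (ha : ∀ i, a i ≠ 0) (hL0 : L ≠ 0) (hL : ∀ i, a i ∣ L) :
    ∀ᶠ s : ℕ in Filter.atTop, (partitionCount a (s : ℤ) : ℂ) =
      ∑ ρ ∈ nthRootsFinset L (1 : ℂ), ρ ^ s * (wavePoly a ρ).eval (s : ℂ) := by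
  obtain ⟨n, rfl⟩ : ∃ n, m = n + 1 := ⟨m - 1, by omega⟩
  filter_upwards [Filter.eventually_ge_atTop (partitionNumerator ℂ L a).natDegree] with s hs
  have hL0' : (L : ℂ) ≠ 0 := Nat.cast_ne_zero.2 hL0
  refine mul_left_cancel₀ hL0' ?_
  rw [partitionCount_eq_sum ℂ ha hL0 hL, Finset.mul_sum, Finset.mul_sum]
  have hterm : ∀ ρ ∈ nthRootsFinset L (1 : ℂ), (L : ℂ) * (ρ ^ s * (wavePoly a ρ).eval (s : ℂ)) =
      ∑ k ∈ Finset.range (s + 1), ρ ^ (s - k) * ((partitionNumerator ℂ L a).coeff k *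
        PowerSeries.coeff n (PowerSeries.rescale (((s : ℂ) - k) / L) (PowerSeries.exp ℂ) *
          toddSeries ℂ ^ (n + 1))) := by
    intro ρ hρ
    have hρL : ρ ^ L = 1 := (mem_nthRootsFinset (Nat.pos_of_ne_zero hL0) 1).1 hρ
    have hρ0 : ρ ≠ 0 := ne_zero_of_mem_nthRootsFinset one_ne_zero hρ
    rw [mul_left_comm, eval_wavePoly ha hL0 hL hρL (Nat.lt_succ_of_le hs), Finset.mul_sum]
    refine Finset.sum_congr rfl fun k hk => ?_
    rw [pow_sub₀ ρ hρ0 (Nat.lt_succ_iff.1 (Finset.mem_range.1 hk)), inv_pow]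
    ring
  rw [Finset.sum_congr rfl hterm, Finset.sum_comm]
  refine Finset.sum_congr rfl fun k hk => ?_
  rw [← Finset.sum_mul, sum_nthRootsFinset_pow hL0]
  split_ifs with h
  · obtain ⟨q, hq⟩ := h
    have hks : k ≤ s := Nat.lt_succ_iff.1 (Finset.mem_range.1 hk)
    have : ((s : ℂ) - k) / L = (q : ℂ) := by
      rw [← Nat.cast_sub hks, hq, Nat.cast_mul, mul_div_cancel_left₀ _ hL0']
    rw [this, coeff_exp_mul_toddSeries_pow, hq, Nat.mul_div_cancel_left _ (Nat.pos_of_ne_zero hL0)]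
  · simp

/-- The sum over the wave periods may be extended to all `L`-th roots of unity, for a common multiple
`L` of the generators, if `f` vanishes at the roots whose order divides no generator. -/
theorem sum_wavePeriods_eq_sum_nthRootsFinset {m L : ℕ} (hL0 : L ≠ 0) {e : Fin m → ℤ}
    (he : ∀ i, e i ≠ 0) (hL : ∀ i, (e i).natAbs ∣ L) {f : ℂ → ℂ}
    (hf : ∀ ρ, (∀ i, ρ ^ (e i).natAbs ≠ 1) → f ρ = 0) :
    ∑ j ∈ wavePeriods e, ∑ ρ ∈ primitiveRoots j ℂ, f ρ =
      ∑ ρ ∈ nthRootsFinset L (1 : ℂ), f ρ := by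
  classical
  have hdisj (s : Set ℕ) : s.PairwiseDisjoint fun j => primitiveRoots j ℂ :=
    fun _ _ _ _ h => IsPrimitiveRoot.disjoint h
  rw [IsPrimitiveRoot.nthRoots_one_eq_biUnion_primitiveRoots, Finset.sum_biUnion (hdisj _)]
  refine Finset.sum_subset (fun j hj => ?_) fun j hj hj' => Finset.sum_eq_zero fun ρ hρ => ?_
  · obtain ⟨i, -, hi⟩ := Finset.mem_biUnion.1 hj
    exact Nat.mem_divisors.2 ⟨(Nat.dvd_of_mem_divisors hi).trans (hL i), hL0⟩
  · refine hf ρ fun i hi => hj' (Finset.mem_biUnion.2 ⟨i, Finset.mem_univ i, ?_⟩)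
    exact Nat.mem_divisors.2 ⟨(isPrimitiveRoot_of_mem_primitiveRoots hρ).dvd_of_pow_eq_one _ hi,
      Int.natAbs_ne_zero.2 (he i)⟩

/-! ### The polynomial part for nonzero generators -/

/-- The polynomial part of the partition function with generators `e`, whose value at `s` is the
coefficient of `t ^ (m - 1)` in `e ^ (s t) ∏ i, φ (e i t) / e i` with `φ` the Todd series. -/
noncomputable def polynomialPart {m : ℕ} (e : Fin m → ℤ) : ℝ[X] :=
  expMulCoeff (m - 1)
    (∏ i, (PowerSeries.C (e i : ℝ)⁻¹ * PowerSeries.rescale (e i : ℝ) (toddSeries ℝ)))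

theorem prod_rescale_exp {ι K : Type*} [Field K] [CharZero K] (s : Finset ι) (c : ι → K) :
    ∏ i ∈ s, PowerSeries.rescale (c i) (PowerSeries.exp K) =
      PowerSeries.rescale (∑ i ∈ s, c i) (PowerSeries.exp K) := by
  classical
  induction s using Finset.induction_on with
  | empty => simp
  | insert i s hi ih =>
    rw [Finset.prod_insert hi, Finset.sum_insert hi, ih, PowerSeries.exp_mul_exp_eq_exp_add]

/-- The reflection of the Todd series in the negative generators matches the replacement of
`1 / (1 - t ^ (-a))` by `-t ^ a / (1 - t ^ a)` in the partition function. -/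
theorem prod_todd_eq_prod_waveFactor_one {m : ℕ} {e : Fin m → ℤ} :
    ∏ i, (PowerSeries.C (e i : ℂ)⁻¹ * PowerSeries.rescale (e i : ℂ) (toddSeries ℂ)) =
      PowerSeries.C ((-1) ^ (Finset.univ.filter fun i => e i < 0).card) *
        PowerSeries.rescale ((∑ i ∈ Finset.univ.filter (fun i => e i < 0), e i : ℤ) : ℂ)
          (PowerSeries.exp ℂ) * ∏ i, waveFactor 1 (e i).natAbs := by
  rw [Int.cast_sum, ← prod_rescale_exp, map_pow, ← Finset.prod_const, Finset.prod_filter,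
    Finset.prod_filter, ← Finset.prod_mul_distrib, ← Finset.prod_mul_distrib]
  refine Finset.prod_congr rfl fun i _ => ?_
  rw [waveFactor, if_pos (one_pow _)]
  split_ifs with h
  · have hcast : ((e i).natAbs : ℂ) = -(e i : ℂ) := by
      rw [Nat.cast_natAbs, abs_of_neg h, Int.cast_neg]
    rw [hcast]
    have hr := rescale_neg_toddSeries (-(e i : ℂ))
    rw [neg_neg] at hr
    rw [hr, inv_neg, map_neg, map_neg, map_one]
    ring
  · have hcast : ((e i).natAbs : ℂ) = (e i : ℂ) := by
      rw [Nat.cast_natAbs, abs_of_nonneg (not_lt.1 h)]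
    rw [hcast]
    ring

theorem isPolynomialPart_polynomialPart {m : ℕ} (hm : 1 ≤ m) {e : Fin m → ℤ}
    (he : ∀ i, e i ≠ 0) : IsPolynomialPart e (polynomialPart e) := by
  set K := (Finset.univ.filter fun i => e i < 0).card with hK
  set c : ℤ := ∑ i ∈ Finset.univ.filter (fun i => e i < 0), e i with hc
  set a : Fin m → ℕ := fun i => (e i).natAbs with ha
  have ha0 (i : Fin m) : a i ≠ 0 := Int.natAbs_ne_zero.2 (he i)
  set L : ℕ := ∏ i, a i with hLdef
  have hL0 : L ≠ 0 := Finset.prod_ne_zero_iff.2 fun i _ => ha0 i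
  have hL (i : Fin m) : a i ∣ L := Finset.dvd_prod_of_mem a (Finset.mem_univ i)
  refine ⟨fun ρ => C ((-1) ^ K * ρ ^ c) * (wavePoly a ρ).comp (X + C (c : ℂ)), ?_, ?_⟩
  · obtain ⟨N, hN⟩ := Filter.eventually_atTop.1 (partitionCount_eq_sum_wavePoly hm ha0 hL0 hL)
    filter_upwards [Filter.eventually_ge_atTop (N + c.natAbs)] with s hs
    rw [sum_wavePeriods_eq_sum_nthRootsFinset hL0 he hL (f := fun ρ => ρ ^ s *
      (C ((-1) ^ K * ρ ^ c) * (wavePoly a ρ).comp (X + C (c : ℂ))).eval (s : ℂ))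
      fun ρ hρ => by rw [wavePoly_eq_zero hm hρ]; simp]
    obtain ⟨s', hs'⟩ : ∃ s' : ℕ, (s' : ℤ) = s + c := ⟨((s : ℤ) + c).toNat, by omega⟩
    have hcast : (s' : ℂ) = s + c := by exact_mod_cast congrArg (Int.cast : ℤ → ℂ) hs'
    rw [scalarPartition, ← hc, ← hK, ← hs']
    push_cast
    rw [hN s' (by omega), Finset.mul_sum]
    refine Finset.sum_congr rfl fun ρ hρ => ?_
    have hρ0 : ρ ≠ 0 := ne_zero_of_mem_nthRootsFinset one_ne_zero hρ
    have hpow : ρ ^ s' = ρ ^ s * ρ ^ c := by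
      rw [← zpow_natCast, hs', zpow_add₀ hρ0, zpow_natCast]
    rw [hpow, hcast]
    simp
    ring
  · refine funext fun z => ?_
    rw [polynomialPart, map_expMulCoeff, eval_expMulCoeff, map_prod]
    have hmap (i : Fin m) : PowerSeries.map (algebraMap ℝ ℂ)
        (PowerSeries.C (e i : ℝ)⁻¹ * PowerSeries.rescale (e i : ℝ) (toddSeries ℝ)) =
        PowerSeries.C (e i : ℂ)⁻¹ * PowerSeries.rescale (e i : ℂ) (toddSeries ℂ) := by
      rw [map_mul, ← PowerSeries.rescale_map, map_toddSeries, PowerSeries.map_C]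
      simp
    simp only [hmap]
    rw [prod_todd_eq_prod_waveFactor_one, ← hK, ← hc, mul_assoc, mul_left_comm,
      PowerSeries.coeff_C_mul, ← mul_assoc, PowerSeries.exp_mul_exp_eq_exp_add, one_zpow, mul_one,
      eval_mul, eval_C, eval_comp, wavePoly, eval_expMulCoeff]
    simp [ha]

theorem existsUnique_isPolynomialPart {m : ℕ} (hm : 1 ≤ m) {e : Fin m → ℤ}
    (he : ∀ i, e i ≠ 0) : ∃! p : ℝ[X], IsPolynomialPart e p := by
  classical
  refine ⟨polynomialPart e, isPolynomialPart_polynomialPart hm he, ?_⟩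
  rintro p ⟨P, hP, hP1⟩
  obtain ⟨P', hP', hP1'⟩ := isPolynomialPart_polynomialPart hm he
  refine map_injective (algebraMap ℝ ℂ) (algebraMap ℝ ℂ).injective ?_
  rw [← hP1, ← hP1', ← sub_eq_zero]
  have hL0 : ∏ i, (e i).natAbs ≠ 0 :=
    Finset.prod_ne_zero_iff.2 fun i _ => Int.natAbs_ne_zero.2 (he i)
  refine eq_zero_of_eventually_sum_pow_mul_eval_eq_zero (Q := fun ρ => P ρ - P' ρ)
    (S := (wavePeriods e).biUnion fun j => primitiveRoots j ℂ) hL0 ?_ ?_ ?_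
  · intro ρ hρ
    obtain ⟨j, hj, hρj⟩ := Finset.mem_biUnion.1 hρ
    obtain ⟨i, -, hi⟩ := Finset.mem_biUnion.1 hj
    obtain ⟨q, hq⟩ := (Nat.dvd_of_mem_divisors hi).trans
      (Finset.dvd_prod_of_mem (fun i => (e i).natAbs) (Finset.mem_univ i))
    rw [hq, pow_mul, (isPrimitiveRoot_of_mem_primitiveRoots hρj).pow_eq_one, one_pow]
  · refine Finset.mem_biUnion.2 ⟨1, Finset.mem_biUnion.2 ⟨⟨0, hm⟩, Finset.mem_univ _, ?_⟩, ?_⟩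
    · exact Nat.one_mem_divisors.2 (Int.natAbs_ne_zero.2 (he _))
    · simp
  · filter_upwards [hP, hP'] with s hs hs'
    rw [Finset.sum_biUnion fun _ _ _ _ h => IsPrimitiveRoot.disjoint h, ← sub_eq_zero.2
      (hs.symm.trans hs'), ← Finset.sum_sub_distrib]
    refine Finset.sum_congr rfl fun j _ => ?_
    rw [← Finset.sum_sub_distrib]
    exact Finset.sum_congr rfl fun ρ _ => by rw [eval_sub, mul_sub]

theorem firstWave_eq_coeff {m : ℕ} (hm : 1 ≤ m) {e : Fin m → ℤ} (he : ∀ i, e i ≠ 0) (s : ℝ) :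
    firstWave e s = PowerSeries.coeff (m - 1) (PowerSeries.rescale s (PowerSeries.exp ℝ) *
      ∏ i, PowerSeries.rescale (e i : ℝ) (toddSeries ℝ)) / generatorProd e := by
  have huniq := existsUnique_isPolynomialPart hm he
  have : Classical.epsilon (IsPolynomialPart e) = polynomialPart e :=
    huniq.unique (Classical.epsilon_spec huniq.exists) (isPolynomialPart_polynomialPart hm he)
  rw [firstWave, this, polynomialPart, eval_expMulCoeff, Finset.prod_mul_distrib, ← map_prod,
    mul_left_comm, PowerSeries.coeff_C_mul, Finset.prod_inv_distrib, generatorProd,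
    inv_mul_eq_div]

/-! ### Bernoulli polynomials of higher order -/

theorem inv_expQuotient (a : ℝ) :
    (expQuotient a)⁻¹ = PowerSeries.rescale a (bernoulliPowerSeries ℝ) := by
  have hq : expQuotient a = PowerSeries.rescale a (expQuotient 1) := by
    ext n
    simp [expQuotient]
    ring
  have h0 : PowerSeries.constantCoeff (expQuotient a) ≠ 0 := by simp [expQuotient]
  have h1 : bernoulliPowerSeries ℝ * expQuotient 1 = 1 := by
    have hs := expQuotient_spec 1
    rw [map_one, one_mul, PowerSeries.rescale_one, RingHom.id_apply] at hs
    refine mul_left_cancel₀ (PowerSeries.X_ne_zero (R := ℝ)) ?_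
    rw [mul_one, mul_left_comm, hs, bernoulliPowerSeries_mul_exp_sub_one]
  rw [eq_comm, PowerSeries.eq_inv_iff_mul_eq_one h0, hq, ← map_mul, h1, map_one]

theorem higherBernoulliPoly_div_factorial {m : ℕ} (n : ℕ) (s : ℝ) (e : Fin m → ℤ) :
    higherBernoulliPoly n (s + generatorSum e) (realGenerators e) / (n.factorial : ℝ) =
      PowerSeries.coeff n (PowerSeries.rescale s (PowerSeries.exp ℝ) *
        ∏ i, PowerSeries.rescale (e i : ℝ) (toddSeries ℝ)) := by
  have hn : (n.factorial : ℝ) ≠ 0 := by positivity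
  rw [higherBernoulliPoly, mul_div_cancel_left₀ _ hn, higherBernoulliSeries, generatorSum,
    ← PowerSeries.exp_mul_exp_eq_exp_add, ← prod_rescale_exp, mul_assoc,
    ← Finset.prod_mul_distrib]
  simp only [inv_expQuotient, toddSeries_eq_exp_mul_bernoulliPowerSeries, map_mul, realGenerators]

/-- The Bernoulli numbers of lower index are coefficients of `t ^ n` as well, after multiplication
of the generating function by a power of `t`. -/
theorem higherBernoulliNumber_eq_coeff {m n k : ℕ} (hk : k ≤ n) (e : Fin m → ℤ) :
    higherBernoulliNumber (n - k) (realGenerators e) = ((n - k).factorial : ℝ) *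
      PowerSeries.coeff n (PowerSeries.X ^ k *
        ∏ i, PowerSeries.rescale (e i : ℝ) (bernoulliPowerSeries ℝ)) := by
  obtain ⟨l, rfl⟩ := Nat.exists_eq_add_of_le hk
  rw [higherBernoulliNumber, higherBernoulliPoly, higherBernoulliSeries, Nat.add_sub_cancel_left,
    add_comm k l, PowerSeries.coeff_X_pow_mul]
  simp [inv_expQuotient, realGenerators]

/-! ### The relations for the reduced generators -/

theorem reducedGenerators_ne_zero {m : ℕ} {d δ : Fin m → ℤ} (hd : ∀ i, 0 < d i)
    (hcol : ∀ i j, i ≠ j → δ i * d j ≠ δ j * d i) (i j : Fin m) :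
    reducedGenerators d δ i j ≠ 0 := by
  rw [reducedGenerators]
  split_ifs with h
  · exact (hd i).ne'
  · exact sub_ne_zero.2 (hcol i j (Ne.symm h))

theorem coeff_mul_prod_div_generatorProd_eq_sum {m : ℕ} (hm : 1 ≤ m) {d δ : Fin m → ℤ}
    (hd : ∀ i, 0 < d i) (hδ : ∀ i, 0 < δ i) (hcol : ∀ i j, i ≠ j → δ i * d j ≠ δ j * d i)
    (g φ : PowerSeries ℝ) (hφ : PowerSeries.constantCoeff φ = 1) :
    PowerSeries.coeff (m - 1) (g * ∏ j, PowerSeries.rescale (d j : ℝ) φ) / generatorProd d =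
      ∑ i, PowerSeries.coeff (m - 1) (PowerSeries.rescale (δ i : ℝ) g *
        ∏ j, PowerSeries.rescale (reducedGenerators d δ i j : ℝ) φ) /
          generatorProd (reducedGenerators d δ i) := by
  have h := coeff_mul_prod_rescale_div_eq_sum hm (fun i => (d i : ℝ)) (fun i => (δ i : ℝ))
    (fun i => by exact_mod_cast (hd i).ne') (fun i => by exact_mod_cast (hδ i).ne')
    (fun i j hij => by exact_mod_cast hcol i j hij) g φ hφ
  simpa only [generatorProd, reducedGenerators, apply_ite (Int.cast : ℤ → ℝ), Int.cast_sub,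
    Int.cast_mul] using h

theorem mainTheorem2 (m : ℕ) (hm : 1 ≤ m) (d δ : Fin m → ℤ)
    (hd : ∀ i, 0 < d i) (hδ : ∀ i, 0 < δ i)
    (hcol : ∀ i j, i ≠ j → δ i * d j ≠ δ j * d i) :
    -- the polynomial parts are well defined
    (∃! p : ℝ[X], IsPolynomialPart d p) ∧
    (∀ i, ∃! p : ℝ[X], IsPolynomialPart (reducedGenerators d δ i) p) ∧
    -- the relation between the polynomial parts
    (∀ s : ℝ, firstWave d s = ∑ i, firstWave (reducedGenerators d δ i) (s * δ i)) ∧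
    -- their representation by Bernoulli polynomials of higher order
    (∀ s : ℝ, firstWave d s =
      higherBernoulliPoly (m - 1) (s + generatorSum d) (realGenerators d) /
        (((m - 1).factorial : ℝ) * generatorProd d)) ∧
    (∀ i, ∀ s : ℝ, firstWave (reducedGenerators d δ i) s =
      higherBernoulliPoly (m - 1) (s + generatorSum (reducedGenerators d δ i))
          (realGenerators (reducedGenerators d δ i)) /
        (((m - 1).factorial : ℝ) * generatorProd (reducedGenerators d δ i))) ∧
    -- the relation between the Bernoulli polynomials of higher order
    (∀ s : ℝ,
      higherBernoulliPoly (m - 1) (s + generatorSum d) (realGenerators d) / generatorProd d =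
        ∑ i, higherBernoulliPoly (m - 1) (s * δ i + generatorSum (reducedGenerators d δ i))
          (realGenerators (reducedGenerators d δ i)) / generatorProd (reducedGenerators d δ i)) ∧
    -- the relations between the Bernoulli numbers of higher order
    (∀ k : ℕ, k ≤ m - 1 →
      higherBernoulliNumber (m - k - 1) (realGenerators d) / generatorProd d =
        ∑ i, (δ i : ℝ) ^ k *
          higherBernoulliNumber (m - k - 1) (realGenerators (reducedGenerators d δ i)) /
            generatorProd (reducedGenerators d δ i)) := by
  have hd0 (i : Fin m) : d i ≠ 0 := (hd i).ne'
  have he := reducedGenerators_ne_zero hd hcol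
  have hwave (s : ℝ) : firstWave d s =
      ∑ i, firstWave (reducedGenerators d δ i) (s * δ i) := by
    rw [firstWave_eq_coeff hm hd0, coeff_mul_prod_div_generatorProd_eq_sum hm hd hδ hcol _ _
      constantCoeff_toddSeries]
    refine Finset.sum_congr rfl fun i _ => ?_
    rw [firstWave_eq_coeff hm (he i), PowerSeries.rescale_rescale]
  have hB {e : Fin m → ℤ} (he : ∀ i, e i ≠ 0) (s : ℝ) : firstWave e s =
      higherBernoulliPoly (m - 1) (s + generatorSum e) (realGenerators e) /
        (((m - 1).factorial : ℝ) * generatorProd e) := by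
    rw [← div_div, higherBernoulliPoly_div_factorial, firstWave_eq_coeff hm he]
  have hB' {e : Fin m → ℤ} (he : ∀ i, e i ≠ 0) (s : ℝ) :
      higherBernoulliPoly (m - 1) (s + generatorSum e) (realGenerators e) / generatorProd e =
        ((m - 1).factorial : ℝ) * firstWave e s := by
    have : ((m - 1).factorial : ℝ) ≠ 0 := by positivity
    rw [hB he, ← div_div, div_right_comm, mul_div_cancel₀ _ this]
  refine ⟨existsUnique_isPolynomialPart hm hd0, fun i => existsUnique_isPolynomialPart hm (he i),
    hwave, hB hd0, fun i => hB (he i), fun s => ?_, fun k hk => ?_⟩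
  · rw [hB' hd0, hwave, Finset.mul_sum]
    exact Finset.sum_congr rfl fun i _ => (hB' (he i) _).symm
  · rw [Nat.sub_right_comm]
    simp only [higherBernoulliNumber_eq_coeff hk]
    rw [mul_div_assoc, coeff_mul_prod_div_generatorProd_eq_sum hm hd hδ hcol _ _
      constantCoeff_bernoulliPowerSeries, Finset.mul_sum]
    refine Finset.sum_congr rfl fun i _ => ?_
    rw [map_pow, PowerSeries.rescale_X, mul_pow, ← map_pow, mul_assoc, PowerSeries.coeff_C_mul]
    ring
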